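/- Let $\mathcal F$ be a complex Hilbert space, let $L^2(\mathbb R_+)$ be the complex $L^2$ space of $\mathbb R_+=[0,\infty)$ with Lebesgue measure, and let $L^2(\mathbb R_+)\otimes\mathcal F$ be the Hilbert space tensor product. Let $\mathcal S=(\mathcal S_t)_{t\ge 0}$ be the right-shift semigroup on $L^2(\mathbb R_+)$: $(\mathcal S_tf)(x)=f(x-t)$ if $x\ge t$ and $(\mathcal S_tf)(x)=0$ otherwise. A semigroup on a Hilbert space $\mathcal H$ means a strongly continuous one-parameter semigroup $T=(T_t)_{t\ge0}$ of bounded operators on $\mathcal H$ (that is, $T_0=I$, $T_{s+t}=T_sT_t$, and $t\mapsto T_th$ is continuous for every $h\in\mathcal H$); it is normal if every $T_t$ is normal. Two semigroups $V,W$ on $\mathcal H$ commute if $V_tW_s=W_sV_t$ for all $t,s\ge0$, and doubly commute if moreover $V_tW_s^*=W_s^*V_t$ for all $t,s\ge0$. Let $A=(A_t)_{t\ge0}$ be a semigroup of bounded operators on $L^2(\mathbb R_+)\otimes\mathcal F$. Then $A$ doubly commutes with $\mathcal S\otimes I_{\mathcal F}=(\mathcal S_t\otimes I_{\mathcal F})_{t\ge0}$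 if and only if there exists a semigroup $B=(B_t)_{t\ge0}$ on $\mathcal F$ such that $A_t=I_{L^2(\mathbb R_+)}\otimes B_t$ for all $t\ge0$. In particular, if $A$ is normal, then $A$ commutes with $\mathcal S\otimes I_{\mathcal F}$ if and only if there exists a normal semigroup $B=(B_t)_{t\ge0}$ on $\mathcal F$ such that $A_t=I_{L^2(\mathbb R_+)}\otimes B_t$ for all $t\ge0$. -/

import Mathlib

open MeasureTheory
open scoped NNReal TensorProduct

noncomputable section

/-- Lebesgue measure on the half-line `[0, ∞)`, as a measure on `ℝ` carried by `[0, ∞)`. -/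
abbrev halfLineMeasure : Measure ℝ := volume.restrict (Set.Ici (0 : ℝ))

/-- The complex Hilbert space `L²(ℝ₊)`. -/
abbrev L2HalfLine : Type := Lp ℂ 2 halfLineMeasure

/-- The right translate by `t` of a function on the half-line:
`x ↦ f (x - t)` if `x ≥ t`, and `0` otherwise. -/
def shiftFun (t : ℝ≥0) (f : ℝ → ℂ) : ℝ → ℂ :=
  (Set.Ici (t : ℝ)).indicator fun x => f (x - t)

theorem shift_measurePreserving (t : ℝ≥0) :
    MeasurePreserving (fun x : ℝ => x - t) (volume.restrict (Set.Ici (t : ℝ))) halfLineMeasure := by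
  have h := (measurePreserving_sub_right volume (t : ℝ)).restrict_preimage
    (s := Set.Ici (0 : ℝ)) measurableSet_Ici
  have h2 : (fun x : ℝ => x - t) ⁻¹' Set.Ici (0 : ℝ) = Set.Ici (t : ℝ) := by
    ext x; simp
  rwa [h2] at h

theorem halfLineMeasure_restrict_Ici (t : ℝ≥0) :
    halfLineMeasure.restrict (Set.Ici (t : ℝ)) = volume.restrict (Set.Ici (t : ℝ)) := by
  rw [Measure.restrict_restrict measurableSet_Ici]
  congr 1
  exact Set.inter_eq_left.mpr (Set.Ici_subset_Ici.mpr t.2)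

theorem shiftFun_congr (t : ℝ≥0) {f g : ℝ → ℂ} (h : f =ᵐ[halfLineMeasure] g) :
    shiftFun t f =ᵐ[halfLineMeasure] shiftFun t g := by
  have h1 := (shift_measurePreserving t).quasiMeasurePreserving.ae_eq_comp h
  rw [← halfLineMeasure_restrict_Ici] at h1
  have h2 := (ae_restrict_iff' measurableSet_Ici).mp h1
  filter_upwards [h2] with x hx
  by_cases hxt : x ∈ Set.Ici (t : ℝ)
  · simpa [shiftFun, hxt] using hx hxt
  · simp [shiftFun, hxt]

theorem memLp_shiftFun (t : ℝ≥0) {f : ℝ → ℂ} (hf : MemLp f 2 halfLineMeasure) :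
    MemLp (shiftFun t f) 2 halfLineMeasure := by
  rw [shiftFun, memLp_indicator_iff_restrict measurableSet_Ici, halfLineMeasure_restrict_Ici]
  exact hf.comp_measurePreserving (shift_measurePreserving t)

theorem eLpNorm_shiftFun (t : ℝ≥0) {f : ℝ → ℂ} (hf : MemLp f 2 halfLineMeasure) :
    eLpNorm (shiftFun t f) 2 halfLineMeasure = eLpNorm f 2 halfLineMeasure := by
  rw [shiftFun, eLpNorm_indicator_eq_eLpNorm_restrict measurableSet_Ici,
    halfLineMeasure_restrict_Ici]
  exact eLpNorm_comp_measurePreserving hf.aestronglyMeasurable (shift_measurePreserving t)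

/-- The right shift `S_t` on `L²(ℝ₊)`, as a linear isometry. -/
def shiftIsometry (t : ℝ≥0) : L2HalfLine →ₗᵢ[ℂ] L2HalfLine where
  toFun f := (memLp_shiftFun t (Lp.memLp f)).toLp (shiftFun t f)
  map_add' f g := by
    rw [← MemLp.toLp_add, MemLp.toLp_eq_toLp_iff]
    refine (shiftFun_congr t (Lp.coeFn_add f g)).trans (Filter.Eventually.of_forall fun x => ?_)
    by_cases hx : x ∈ Set.Ici (t : ℝ) <;> simp [shiftFun, hx]
  map_smul' c f := by
    rw [RingHom.id_apply, ← MemLp.toLp_const_smul, MemLp.toLp_eq_toLp_iff]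
    refine (shiftFun_congr t (Lp.coeFn_smul c f)).trans (Filter.Eventually.of_forall fun x => ?_)
    by_cases hx : x ∈ Set.Ici (t : ℝ) <;> simp [shiftFun, hx]
  norm_map' f := by
    change ‖(memLp_shiftFun t (Lp.memLp f)).toLp (shiftFun t f)‖ = ‖f‖
    rw [Lp.norm_toLp, eLpNorm_shiftFun t (Lp.memLp f), Lp.norm_def]

/-- The right-shift semigroup `S = (S_t)_{t ≥ 0}` on `L²(ℝ₊)`. -/
def rightShift (t : ℝ≥0) : L2HalfLine →L[ℂ] L2HalfLine :=
  (shiftIsometry t).toContinuousLinearMap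

theorem rightShift_coeFn (t : ℝ≥0) (f : L2HalfLine) :
    rightShift t f =ᵐ[halfLineMeasure] fun x => if (t : ℝ) ≤ x then f (x - t) else 0 := by
  refine (MemLp.coeFn_toLp (memLp_shiftFun t (Lp.memLp f))).trans
    (Filter.Eventually.of_forall fun x => ?_)
  simp [shiftFun, Set.indicator_apply]

section Tensor

variable (E F : Type*) [NormedAddCommGroup E] [InnerProductSpace ℂ E]
  [NormedAddCommGroup F] [InnerProductSpace ℂ F]

/-- The Hilbert space tensor product: the completion of the algebraic tensor product for the inner
product with `⟪a ⊗ b, c ⊗ d⟫ = ⟪a, c⟫ * ⟪b, d⟫`. -/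
abbrev HilbertTensor : Type _ := UniformSpace.Completion (E ⊗[ℂ] F)

variable {E F}

/-- The tensor product `X ⊗ Y` of two bounded operators: the continuous extension of
`a ⊗ b ↦ X a ⊗ Y b` to the Hilbert space tensor product. -/
def tensorOp (X : E →L[ℂ] E) (Y : F →L[ℂ] F) : HilbertTensor E F →L[ℂ] HilbertTensor E F :=
  (TensorProduct.mapL X Y).completion

theorem tensorOp_tmul (X : E →L[ℂ] E) (Y : F →L[ℂ] F) (a : E) (b : F) :
    tensorOp X Y ((a ⊗ₜ[ℂ] b : E ⊗[ℂ] F) : HilbertTensor E F) =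
      ((X a ⊗ₜ[ℂ] Y b : E ⊗[ℂ] F) : HilbertTensor E F) := by
  simp [tensorOp]

end Tensor

section Semigroups

variable {H : Type*} [NormedAddCommGroup H] [InnerProductSpace ℂ H]

/-- A `C₀`-semigroup: a strongly continuous one-parameter semigroup `(T_t)_{t ≥ 0}` of bounded
operators. -/
structure IsC0Semigroup (T : ℝ≥0 → H →L[ℂ] H) : Prop where
  map_zero : T 0 = ContinuousLinearMap.id ℂ H
  map_add : ∀ s t, T (s + t) = T s ∘L T t
  strongly_continuous : ∀ x, Continuous fun t => T t x

/-- Two families of operators commute: `V_t W_s = W_s V_t` for all `t, s ≥ 0`. -/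
def CommuteWith (V W : ℝ≥0 → H →L[ℂ] H) : Prop :=
  ∀ t s, V t ∘L W s = W s ∘L V t

variable [CompleteSpace H]

/-- Two families of operators doubly commute: they commute, and `V_t W_s^* = W_s^* V_t` for all
`t, s ≥ 0`. -/
def DoublyCommuteWith (V W : ℝ≥0 → H →L[ℂ] H) : Prop :=
  CommuteWith V W ∧
    ∀ t s, V t ∘L ContinuousLinearMap.adjoint (W s) = ContinuousLinearMap.adjoint (W s) ∘L V t

/-- A normal semigroup: a `C₀`-semigroup all of whose operators are normal. -/
structure IsNormalC0Semigroup (T : ℝ≥0 → H →L[ℂ] H) : Prop extends IsC0Semigroup T where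
  normal : ∀ t, T t ∘L ContinuousLinearMap.adjoint (T t) = ContinuousLinearMap.adjoint (T t) ∘L T t

end Semigroups

/-- The semigroup `S ⊗ I_F` on `L²(ℝ₊) ⊗ F`. -/
def shiftTensor (F : Type*) [NormedAddCommGroup F] [InnerProductSpace ℂ F] (t : ℝ≥0) :
    HilbertTensor L2HalfLine F →L[ℂ] HilbertTensor L2HalfLine F :=
  tensorOp (rightShift t) (ContinuousLinearMap.id ℂ F)

end

/-! ### Indicators of initial intervals in `L²(ℝ₊)` -/

open scoped InnerProductSpace

/-! Write `1_t` for the indicator of `[0, t)`. It satisfies `1_{s+t} = 1_s + S_s 1_t` and `S_s^* 1_s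
= 0`. If `T` commutes with `S_s ⊗ I` and its adjoint, then `T (1_s ⊗ φ)` is orthogonal to the range
of `S_s ⊗ I`. Hence `t ↦ ⟪T (1_t ⊗ φ), 1_t ⊗ ψ⟫` is additive and bounded on `[0, 1]`, so linear, and
the mixed matrix coefficients are `min s t` times the one at `1` (`inner_icoIndicator`). Since the
`1_t` span a dense subspace, `T` is determined by its compression `B` to `1_1 ⊗ F`. As `I ⊗ B` has
the same commutation relations and the same compression, `T = I ⊗ B`
(`eq_tensorOp_compressToUnitInterval`). Semigroup identities and normality pass to `B` because `B ↦
I ⊗ B` is injective. In the normal case, Fuglede's theorem upgrades commutation to double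
commutation. -/

theorem halfLineMeasure_Ico_ne_top (t : ℝ≥0) : halfLineMeasure (Set.Ico (0 : ℝ) t) ≠ ⊤ :=
  ((Measure.restrict_apply_le _ _).trans_lt (by simp)).ne

/-- The indicator function of `[0, t)` as an element of `L²(ℝ₊)`. -/
noncomputable def icoIndicator (t : ℝ≥0) : L2HalfLine :=
  indicatorConstLp 2 (measurableSet_Ico (a := (0 : ℝ)) (b := t)) (halfLineMeasure_Ico_ne_top t) 1

theorem icoIndicator_coeFn (t : ℝ≥0) :
    icoIndicator t =ᵐ[halfLineMeasure] (Set.Ico (0 : ℝ) t).indicator fun _ => 1 :=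
  indicatorConstLp_coeFn

theorem ae_halfLineMeasure_nonneg : ∀ᵐ x ∂halfLineMeasure, (0 : ℝ) ≤ x :=
  ae_restrict_mem measurableSet_Ici

theorem icoIndicator_add (s t : ℝ≥0) :
    icoIndicator (s + t) = icoIndicator s + rightShift s (icoIndicator t) := by
  apply Lp.ext
  have h := (MemLp.coeFn_toLp (memLp_shiftFun s (Lp.memLp (icoIndicator t)))).trans
    (shiftFun_congr s (icoIndicator_coeFn t))
  have h' : rightShift s (icoIndicator t) =ᵐ[halfLineMeasure] _ := h
  filter_upwards [icoIndicator_coeFn (s + t), icoIndicator_coeFn s, h',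
    Lp.coeFn_add (icoIndicator s) (rightShift s (icoIndicator t)), ae_halfLineMeasure_nonneg]
    with x h1 h2 h3 h4 h0
  rw [h1, h4, Pi.add_apply, h2, h3]
  have ht := t.2
  by_cases hs : (s : ℝ) ≤ x
  · by_cases hx : x < s + t
    · simp [shiftFun, Set.indicator_apply, hs, hx, h0, sub_lt_iff_lt_add']
    · simp [shiftFun, Set.indicator_apply, hs, hx, h0, sub_lt_iff_lt_add']
  · have : x < s + t := by push Not at hs; exact lt_of_lt_of_le hs (by simp)
    simp [shiftFun, Set.indicator_apply, hs, this, h0, not_le.mp hs]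

/-- The range of `S_s` consists of functions vanishing a.e. on `[0, s)`. -/
theorem adjoint_rightShift_icoIndicator (s : ℝ≥0) :
    (rightShift s).adjoint (icoIndicator s) = 0 := by
  refine ext_inner_right ℂ fun f => ?_
  rw [ContinuousLinearMap.adjoint_inner_left, inner_zero_left, icoIndicator,
    L2.inner_indicatorConstLp_one]
  refine integral_eq_zero_of_ae ?_
  filter_upwards [ae_restrict_of_ae (rightShift_coeFn s f), ae_restrict_mem measurableSet_Ico]
    with x hx hm
  rw [hx, if_neg (not_le.mpr hm.2), Pi.zero_apply]

theorem norm_icoIndicator (t : ℝ≥0) : ‖icoIndicator t‖ = √t := by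
  rw [icoIndicator, norm_indicatorConstLp (by simp) (by simp), measureReal_def,
    Measure.restrict_apply measurableSet_Ico, Set.inter_eq_left.mpr Set.Ico_subset_Ici_self]
  simp [Real.sqrt_eq_rpow]

/-- A function orthogonal to every indicator has zero primitive, so it vanishes a.e. by Lebesgue
differentiation. -/
theorem dense_span_icoIndicator :
    Dense (Submodule.span ℂ (Set.range icoIndicator) : Set L2HalfLine) := by
  rw [Submodule.dense_iff_topologicalClosure_eq_top, Submodule.topologicalClosure_eq_top_iff,
    Submodule.eq_bot_iff]
  intro f hf
  have hint (t : ℝ≥0) : ∫ x in (0 : ℝ)..t, (Set.Ici (0 : ℝ)).indicator f x = 0 := by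
    have h := (Submodule.mem_orthogonal _ _).mp hf _ (Submodule.subset_span ⟨t, rfl⟩)
    rw [icoIndicator, L2.inner_indicatorConstLp_one,
      Measure.restrict_restrict measurableSet_Ico,
      Set.inter_eq_left.mpr Set.Ico_subset_Ici_self] at h
    rw [intervalIntegral.integral_of_le t.coe_nonneg, ← integral_Ico_eq_integral_Ioc, ← h]
    exact setIntegral_congr_fun measurableSet_Ico fun x hx => Set.indicator_of_mem hx.1 _
  have hloc : LocallyIntegrable ((Set.Ici (0 : ℝ)).indicator f) volume :=
    ((memLp_indicator_iff_restrict measurableSet_Ici).mpr (Lp.memLp f)).locallyIntegrable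
      (by norm_num)
  apply Lp.ext
  rw [Filter.EventuallyEq, ae_restrict_iff' measurableSet_Ici]
  -- The primitive is known to vanish only on `[0, ∞)`, which is a neighbourhood of `x` only when `x
  -- > 0`.
  have hne : ∀ᵐ x : ℝ, x ≠ 0 := by simp [ae_iff, measure_singleton]
  filter_upwards [LocallyIntegrable.ae_hasDerivAt_integral hloc, hne,
    (ae_restrict_iff' measurableSet_Ici).mp (Lp.coeFn_zero ℂ 2 halfLineMeasure)] with x hx hx0 hz h0
  rw [hz h0]
  have hpos : 0 < x := lt_of_le_of_ne h0 (Ne.symm hx0)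
  have h1 := hx 0
  rw [Set.indicator_of_mem h0] at h1
  refine h1.unique ((hasDerivAt_const x (0 : ℂ)).congr_of_eventuallyEq ?_)
  filter_upwards [lt_mem_nhds hpos] with y hy
  exact hint ⟨y, hy.le⟩

/-- The difference `g t = m t - t • m 1` is additive and 1-periodic, hence bounded everywhere;
boundedness of `n • g t = g (n • t)` in `n` forces `g = 0`. -/
theorem eq_smul_of_additive_of_bounded {E : Type*} [NormedAddCommGroup E] [NormedSpace ℝ E]
    (m : ℝ≥0 → E) (hadd : ∀ s t, m (s + t) = m s + m t) (C : ℝ) (hC : ∀ t ≤ 1, ‖m t‖ ≤ C)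
    (t : ℝ≥0) : m t = (t : ℝ) • m 1 := by
  let f : ℝ≥0 →+ E := AddMonoidHom.mk' m hadd
  let g : ℝ≥0 →+ E := f - AddMonoidHom.mk' (fun t : ℝ≥0 => (t : ℝ) • m 1)
    fun s t => by simp [add_smul]
  have hg (t : ℝ≥0) : g t = m t - (t : ℝ) • m 1 := rfl
  have hg1 : g 1 = 0 := by simp [hg]
  have hb (t : ℝ≥0) : ‖g t‖ ≤ C + C := by
    have h1 : g t = g (t - ⌊t⌋₊) := by
      conv_lhs => rw [← tsub_add_cancel_of_le (Nat.floor_le (zero_le (a := t))), map_add,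
        ← nsmul_one, map_nsmul, hg1, smul_zero, add_zero]
      rw [nsmul_one]
    have h2 : t - ⌊t⌋₊ ≤ 1 := by
      rw [tsub_le_iff_left]; exact (Nat.lt_floor_add_one t).le
    rw [h1, hg]
    refine (norm_sub_le _ _).trans (add_le_add (hC _ h2) ?_)
    rw [norm_smul]
    refine (mul_le_of_le_one_left (norm_nonneg _) ?_).trans (hC 1 le_rfl)
    simpa using h2
  have hn (n : ℕ) : n * ‖g t‖ ≤ C + C := by
    have := hb (n • t)
    rwa [map_nsmul, ← Nat.cast_smul_eq_nsmul ℝ, norm_smul, Real.norm_natCast] at this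
  have h0 : ‖g t‖ = 0 := by
    by_contra hne
    have hpos : 0 < ‖g t‖ := lt_of_le_of_ne (norm_nonneg _) (Ne.symm hne)
    obtain ⟨n, hn'⟩ := exists_nat_gt ((C + C) / ‖g t‖)
    rw [div_lt_iff₀ hpos] at hn'
    exact absurd (hn n) (not_le.mpr hn')
  rw [norm_eq_zero, hg, sub_eq_zero] at h0
  exact h0

/-! ### Elementary tensors and operators on the Hilbert space tensor product -/

section Tensor

variable {E F G : Type*} [NormedAddCommGroup E] [InnerProductSpace ℂ E]
  [NormedAddCommGroup F] [InnerProductSpace ℂ F] [NormedAddCommGroup G] [NormedSpace ℂ G]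

/-- The elementary tensor `a ⊗ b` in the Hilbert space tensor product, as a bilinear map. -/
noncomputable def hilbertTmul : E →ₗ[ℂ] F →ₗ[ℂ] HilbertTensor E F :=
  (TensorProduct.mk ℂ E F).compr₂ (UniformSpace.Completion.toComplₗᵢ (𝕜 := ℂ)).toLinearMap

theorem hilbertTmul_apply (a : E) (b : F) :
    hilbertTmul a b = ((a ⊗ₜ[ℂ] b : E ⊗[ℂ] F) : HilbertTensor E F) := rfl

theorem inner_hilbertTmul (a c : E) (b d : F) :
    ⟪hilbertTmul a b, hilbertTmul c d⟫_ℂ = ⟪a, c⟫_ℂ * ⟪b, d⟫_ℂ := by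
  simp [hilbertTmul_apply]

theorem norm_hilbertTmul (a : E) (b : F) : ‖hilbertTmul a b‖ = ‖a‖ * ‖b‖ := by
  simp [hilbertTmul_apply]

theorem tensorOp_hilbertTmul (X : E →L[ℂ] E) (Y : F →L[ℂ] F) (a : E) (b : F) :
    tensorOp X Y (hilbertTmul a b) = hilbertTmul (X a) (Y b) :=
  tensorOp_tmul X Y a b

theorem HilbertTensor.clm_ext {X Y : HilbertTensor E F →L[ℂ] G}
    (h : ∀ a b, X (hilbertTmul a b) = Y (hilbertTmul a b)) : X = Y := by
  ext x
  induction x using UniformSpace.Completion.induction_on with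
  | hp => exact isClosed_eq X.continuous Y.continuous
  | ih x =>
    induction x using TensorProduct.induction_on with
    | zero => rw [UniformSpace.Completion.coe_zero, map_zero, map_zero]
    | tmul a b => exact h a b
    | add x y hx hy => rw [UniformSpace.Completion.coe_add, map_add, map_add, hx, hy]

theorem HilbertTensor.ext_inner {x y : HilbertTensor E F}
    (h : ∀ a b, ⟪x, hilbertTmul a b⟫_ℂ = ⟪y, hilbertTmul a b⟫_ℂ) : x = y := by
  have : innerSL ℂ x = innerSL ℂ y := HilbertTensor.clm_ext h
  exact ext_inner_right ℂ fun v => DFunLike.congr_fun this v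

/-- Tensoring with a fixed vector of the first factor, as a bounded operator. -/
noncomputable def hilbertTmulLeft (a : E) : F →L[ℂ] HilbertTensor E F :=
  (hilbertTmul a).mkContinuous ‖a‖ fun b => (norm_hilbertTmul a b).le

@[simp] theorem hilbertTmulLeft_apply (a : E) (b : F) :
    hilbertTmulLeft a b = hilbertTmul a b := rfl

/-- Tensoring with a fixed vector of the second factor, as a bounded operator. -/
noncomputable def hilbertTmulRight (b : F) : E →L[ℂ] HilbertTensor E F :=
  (hilbertTmul.flip b).mkContinuous ‖b‖ fun a => by
    rw [LinearMap.flip_apply, norm_hilbertTmul, mul_comm]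

@[simp] theorem hilbertTmulRight_apply (a : E) (b : F) :
    hilbertTmulRight b a = hilbertTmul a b := rfl

theorem tensorOp_comp (X X' : E →L[ℂ] E) (Y Y' : F →L[ℂ] F) :
    tensorOp X Y ∘L tensorOp X' Y' = tensorOp (X ∘L X') (Y ∘L Y') :=
  HilbertTensor.clm_ext fun a b => by simp [tensorOp_hilbertTmul]

theorem adjoint_tensorOp [CompleteSpace E] [CompleteSpace F] (X : E →L[ℂ] E) (Y : F →L[ℂ] F) :
    (tensorOp X Y).adjoint = tensorOp X.adjoint Y.adjoint :=
  HilbertTensor.clm_ext fun a b => HilbertTensor.ext_inner fun c d => by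
    simp only [ContinuousLinearMap.adjoint_inner_left, tensorOp_hilbertTmul, inner_hilbertTmul]

theorem adjoint_hilbertTmulLeft_comp_self [CompleteSpace F] {a : E} (ha : ‖a‖ = 1)
    (b : F) : (hilbertTmulLeft a).adjoint (hilbertTmul a b) = b := by
  refine ext_inner_right ℂ fun d => ?_
  rw [ContinuousLinearMap.adjoint_inner_left, hilbertTmulLeft_apply, inner_hilbertTmul,
    inner_self_eq_norm_sq_to_K, ha]
  simp

/-- `B` is recovered by slicing `I ⊗ B` along the unit vector `a`. -/
theorem tensorOp_id_injective [CompleteSpace F] {a : E} (ha : ‖a‖ = 1) {Y Y' : F →L[ℂ] F}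
    (h : tensorOp (ContinuousLinearMap.id ℂ E) Y = tensorOp (ContinuousLinearMap.id ℂ E) Y') :
    Y = Y' := by
  ext b
  have := congrArg (hilbertTmulLeft a).adjoint (DFunLike.congr_fun h (hilbertTmul a b))
  simpa [tensorOp_hilbertTmul, adjoint_hilbertTmulLeft_comp_self ha] using this

end Tensor

/-! ### Operators commuting with the shift and its adjoint -/

section Commutant

variable {F : Type*} [NormedAddCommGroup F] [InnerProductSpace ℂ F]

theorem shiftTensor_hilbertTmul (t : ℝ≥0) (f : L2HalfLine) (φ : F) :
    shiftTensor F t (hilbertTmul f φ) = hilbertTmul (rightShift t f) φ :=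
  tensorOp_hilbertTmul _ _ f φ

theorem adjoint_shiftTensor_hilbertTmul (t : ℝ≥0) (f : L2HalfLine) (φ : F) :
    (shiftTensor F t).adjoint (hilbertTmul f φ) = hilbertTmul ((rightShift t).adjoint f) φ :=
  HilbertTensor.ext_inner fun c d => by
    simp only [ContinuousLinearMap.adjoint_inner_left, shiftTensor_hilbertTmul, inner_hilbertTmul]

theorem adjoint_shiftTensor_comp_self (t : ℝ≥0) (x : HilbertTensor L2HalfLine F) :
    (shiftTensor F t).adjoint (shiftTensor F t x) = x := by
  have : (shiftTensor F t).adjoint ∘L shiftTensor F t = ContinuousLinearMap.id ℂ _ :=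
    HilbertTensor.clm_ext fun f φ => HilbertTensor.ext_inner fun g ψ => by
      simp only [ContinuousLinearMap.comp_apply, ContinuousLinearMap.adjoint_inner_left,
        shiftTensor_hilbertTmul, inner_hilbertTmul, ContinuousLinearMap.id_apply]
      rw [show ⟪rightShift t f, rightShift t g⟫_ℂ = ⟪f, g⟫_ℂ from
        (shiftIsometry t).inner_map_map f g]
  exact DFunLike.congr_fun this x

theorem hilbertTmul_icoIndicator_add (s t : ℝ≥0) (φ : F) :
    hilbertTmul (icoIndicator (s + t)) φ =
      hilbertTmul (icoIndicator s) φ + shiftTensor F s (hilbertTmul (icoIndicator t) φ) := by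
  rw [icoIndicator_add, map_add, LinearMap.add_apply, shiftTensor_hilbertTmul]

theorem adjoint_shiftTensor_icoIndicator (s : ℝ≥0) (φ : F) :
    (shiftTensor F s).adjoint (hilbertTmul (icoIndicator s) φ) = 0 := by
  rw [adjoint_shiftTensor_hilbertTmul, adjoint_rightShift_icoIndicator, map_zero,
    LinearMap.zero_apply]

variable {T : HilbertTensor L2HalfLine F →L[ℂ] HilbertTensor L2HalfLine F}
  (hT : ∀ s, T ∘L shiftTensor F s = shiftTensor F s ∘L T)
  (hT' : ∀ s, T ∘L (shiftTensor F s).adjoint = (shiftTensor F s).adjoint ∘L T)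

include hT' in
-- `T` preserves the kernel of `(S_s ⊗ I)^*`, the orthogonal complement of the range of `S_s ⊗ I`.
theorem inner_icoIndicator_shiftTensor_right (s t : ℝ≥0) (φ ψ : F) :
    ⟪T (hilbertTmul (icoIndicator s) φ),
      shiftTensor F s (hilbertTmul (icoIndicator t) ψ)⟫_ℂ = 0 := by
  have h := DFunLike.congr_fun (hT' s) (hilbertTmul (icoIndicator s) φ)
  simp only [ContinuousLinearMap.comp_apply, adjoint_shiftTensor_icoIndicator, map_zero] at h
  rw [← ContinuousLinearMap.adjoint_inner_left, ← h, inner_zero_left]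

include hT in
theorem inner_shiftTensor_icoIndicator_left (s t : ℝ≥0) (φ ψ : F) :
    ⟪T (shiftTensor F s (hilbertTmul (icoIndicator t) φ)),
      hilbertTmul (icoIndicator s) ψ⟫_ℂ = 0 := by
  have h := DFunLike.congr_fun (hT s) (hilbertTmul (icoIndicator t) φ)
  simp only [ContinuousLinearMap.comp_apply] at h
  rw [h, ← ContinuousLinearMap.adjoint_inner_right, adjoint_shiftTensor_icoIndicator,
    inner_zero_right]

include hT hT'

/-- After splitting `1_{s+t}`, the cross terms vanish by orthogonality, and the shifted term loses
its shift because `S_s ⊗ I` is an isometry commuting with `T`. -/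
theorem inner_icoIndicator_diag_add (s t : ℝ≥0) (φ ψ : F) :
    ⟪T (hilbertTmul (icoIndicator (s + t)) φ), hilbertTmul (icoIndicator (s + t)) ψ⟫_ℂ =
      ⟪T (hilbertTmul (icoIndicator s) φ), hilbertTmul (icoIndicator s) ψ⟫_ℂ +
        ⟪T (hilbertTmul (icoIndicator t) φ), hilbertTmul (icoIndicator t) ψ⟫_ℂ := by
  have h := DFunLike.congr_fun (hT s) (hilbertTmul (icoIndicator t) φ)
  simp only [ContinuousLinearMap.comp_apply] at h
  rw [hilbertTmul_icoIndicator_add, hilbertTmul_icoIndicator_add, map_add, inner_add_left,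
    inner_add_right, inner_add_right, inner_icoIndicator_shiftTensor_right hT',
    inner_shiftTensor_icoIndicator_left hT, add_zero, zero_add, h,
    ← ContinuousLinearMap.adjoint_inner_right (shiftTensor F s), adjoint_shiftTensor_comp_self]

theorem inner_icoIndicator_diag (t : ℝ≥0) (φ ψ : F) :
    ⟪T (hilbertTmul (icoIndicator t) φ), hilbertTmul (icoIndicator t) ψ⟫_ℂ =
      (t : ℝ) • ⟪T (hilbertTmul (icoIndicator 1) φ), hilbertTmul (icoIndicator 1) ψ⟫_ℂ := by
  refine eq_smul_of_additive_of_bounded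
    (fun t => ⟪T (hilbertTmul (icoIndicator t) φ), hilbertTmul (icoIndicator t) ψ⟫_ℂ)
    (fun s t => inner_icoIndicator_diag_add hT hT' s t φ ψ)
    (‖T‖ * (1 * ‖φ‖) * (1 * ‖ψ‖)) (fun t ht => ?_) t
  have hle : ‖icoIndicator t‖ ≤ 1 := by
    rw [norm_icoIndicator, Real.sqrt_le_one]; exact_mod_cast ht
  refine (norm_inner_le_norm _ _).trans ?_
  grw [T.le_opNorm, norm_hilbertTmul, norm_hilbertTmul, hle, hle]

theorem inner_icoIndicator (s t : ℝ≥0) (φ ψ : F) :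
    ⟪T (hilbertTmul (icoIndicator s) φ), hilbertTmul (icoIndicator t) ψ⟫_ℂ =
      ((min s t : ℝ≥0) : ℝ) •
        ⟪T (hilbertTmul (icoIndicator 1) φ), hilbertTmul (icoIndicator 1) ψ⟫_ℂ := by
  -- The target is now the diagonal coefficient at `min s t`; the excess of the longer indicator is
  -- a shifted vector and contributes nothing.
  rw [← inner_icoIndicator_diag hT hT']
  rcases le_total s t with h | h
  · obtain ⟨u, rfl⟩ := exists_add_of_le h
    rw [min_eq_left h, hilbertTmul_icoIndicator_add, inner_add_right,
      inner_icoIndicator_shiftTensor_right hT', add_zero]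
  · obtain ⟨u, rfl⟩ := exists_add_of_le h
    rw [min_eq_right h, hilbertTmul_icoIndicator_add, map_add, inner_add_left,
      inner_shiftTensor_icoIndicator_left hT, add_zero]

omit hT hT'

theorem HilbertTensor.clm_ext_icoIndicator {G : Type*} [NormedAddCommGroup G] [NormedSpace ℂ G]
    {X Y : HilbertTensor L2HalfLine F →L[ℂ] G}
    (h : ∀ t φ, X (hilbertTmul (icoIndicator t) φ) = Y (hilbertTmul (icoIndicator t) φ)) :
    X = Y := by
  refine HilbertTensor.clm_ext fun f φ => ?_
  have : X ∘L hilbertTmulRight φ = Y ∘L hilbertTmulRight φ := by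
    refine ContinuousLinearMap.ext_on dense_span_icoIndicator ?_
    rintro _ ⟨t, rfl⟩
    exact h t φ
  exact DFunLike.congr_fun this f

theorem eq_of_commute_shiftTensor
    {T T' : HilbertTensor L2HalfLine F →L[ℂ] HilbertTensor L2HalfLine F}
    (hT : ∀ s, T ∘L shiftTensor F s = shiftTensor F s ∘L T)
    (hT' : ∀ s, T ∘L (shiftTensor F s).adjoint = (shiftTensor F s).adjoint ∘L T)
    (hX : ∀ s, T' ∘L shiftTensor F s = shiftTensor F s ∘L T')
    (hX' : ∀ s, T' ∘L (shiftTensor F s).adjoint = (shiftTensor F s).adjoint ∘L T')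
    (h : ∀ φ ψ, ⟪T (hilbertTmul (icoIndicator 1) φ), hilbertTmul (icoIndicator 1) ψ⟫_ℂ =
      ⟪T' (hilbertTmul (icoIndicator 1) φ), hilbertTmul (icoIndicator 1) ψ⟫_ℂ) : T = T' := by
  refine HilbertTensor.clm_ext_icoIndicator fun s φ => ?_
  have : innerSL ℂ (T (hilbertTmul (icoIndicator s) φ)) =
      innerSL ℂ (T' (hilbertTmul (icoIndicator s) φ)) :=
    HilbertTensor.clm_ext_icoIndicator fun t ψ => by
      simp only [innerSL_apply_apply]
      rw [inner_icoIndicator hT hT', inner_icoIndicator hX hX', h]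
  exact ext_inner_right ℂ fun v => DFunLike.congr_fun this v

theorem tensorOp_id_comp_shiftTensor (B : F →L[ℂ] F) (s : ℝ≥0) :
    tensorOp (ContinuousLinearMap.id ℂ L2HalfLine) B ∘L shiftTensor F s =
      shiftTensor F s ∘L tensorOp (ContinuousLinearMap.id ℂ L2HalfLine) B := by
  simp [shiftTensor, tensorOp_comp]

theorem tensorOp_id_comp_adjoint_shiftTensor (B : F →L[ℂ] F) (s : ℝ≥0) :
    tensorOp (ContinuousLinearMap.id ℂ L2HalfLine) B ∘L (shiftTensor F s).adjoint =
      (shiftTensor F s).adjoint ∘L tensorOp (ContinuousLinearMap.id ℂ L2HalfLine) B :=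
  HilbertTensor.clm_ext fun f φ => by
    simp [adjoint_shiftTensor_hilbertTmul, tensorOp_hilbertTmul]

theorem norm_icoIndicator_one : ‖icoIndicator 1‖ = 1 := by simp [norm_icoIndicator]

theorem doublyCommuteWith_shiftTensor_of_eq_tensorOp
    {A : ℝ≥0 → HilbertTensor L2HalfLine F →L[ℂ] HilbertTensor L2HalfLine F} {B : ℝ≥0 → F →L[ℂ] F}
    (h : ∀ t, A t = tensorOp (ContinuousLinearMap.id ℂ L2HalfLine) (B t)) :
    DoublyCommuteWith A (shiftTensor F) := by
  obtain rfl : A = fun t => tensorOp (ContinuousLinearMap.id ℂ L2HalfLine) (B t) := funext h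
  exact ⟨fun t => tensorOp_id_comp_shiftTensor (B t),
    fun t => tensorOp_id_comp_adjoint_shiftTensor (B t)⟩

variable [CompleteSpace F]

/-- The compression of an operator on `L²(ℝ₊) ⊗ F` to `1_{[0,1)} ⊗ F`. -/
noncomputable def compressToUnitInterval (T : HilbertTensor L2HalfLine F →L[ℂ] HilbertTensor L2HalfLine F) :
    F →L[ℂ] F :=
  (hilbertTmulLeft (icoIndicator 1)).adjoint ∘L T ∘L hilbertTmulLeft (icoIndicator 1)

theorem eq_tensorOp_compressToUnitInterval
    {T : HilbertTensor L2HalfLine F →L[ℂ] HilbertTensor L2HalfLine F}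
    (hT : ∀ s, T ∘L shiftTensor F s = shiftTensor F s ∘L T)
    (hT' : ∀ s, T ∘L (shiftTensor F s).adjoint = (shiftTensor F s).adjoint ∘L T) :
    T = tensorOp (ContinuousLinearMap.id ℂ L2HalfLine) (compressToUnitInterval T) := by
  refine eq_of_commute_shiftTensor hT hT' (tensorOp_id_comp_shiftTensor _)
    (tensorOp_id_comp_adjoint_shiftTensor _) fun φ ψ => ?_
  rw [tensorOp_hilbertTmul, inner_hilbertTmul, ContinuousLinearMap.id_apply,
    inner_self_eq_norm_sq_to_K, norm_icoIndicator_one]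
  simp [compressToUnitInterval, ContinuousLinearMap.adjoint_inner_left]

theorem exists_isC0Semigroup_of_doublyCommuteWith
    {A : ℝ≥0 → HilbertTensor L2HalfLine F →L[ℂ] HilbertTensor L2HalfLine F}
    (hA : IsC0Semigroup A) (h : DoublyCommuteWith A (shiftTensor F)) :
    ∃ B : ℝ≥0 → F →L[ℂ] F, IsC0Semigroup B ∧
      ∀ t, A t = tensorOp (ContinuousLinearMap.id ℂ L2HalfLine) (B t) := by
  have key t := eq_tensorOp_compressToUnitInterval (h.1 t) (h.2 t)
  refine ⟨fun t => compressToUnitInterval (A t), ⟨?_, fun s t => ?_, fun φ => ?_⟩, key⟩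
  · refine tensorOp_id_injective norm_icoIndicator_one ?_
    rw [← key, hA.map_zero]
    exact HilbertTensor.clm_ext fun f φ => by simp [tensorOp_hilbertTmul]
  · refine tensorOp_id_injective norm_icoIndicator_one ?_
    rw [← key, hA.map_add, key s, key t, tensorOp_comp, ContinuousLinearMap.id_comp,
      ← key s, ← key t]
  -- Compression is by fixed bounded operators, so strong continuity is inherited directly.
  · exact (hilbertTmulLeft (icoIndicator 1)).adjoint.continuous.comp
      (hA.strongly_continuous (hilbertTmul (icoIndicator 1) φ))

end Commutant

/-- Fuglede's theorem: what commutes with a normal operator commutes with its adjoint. Taking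
adjoints then moves the star onto `W s`. -/
theorem IsNormalC0Semigroup.doublyCommuteWith {H : Type*} [NormedAddCommGroup H]
    [InnerProductSpace ℂ H] [CompleteSpace H] {V W : ℝ≥0 → H →L[ℂ] H}
    (hV : IsNormalC0Semigroup V) (h : CommuteWith V W) : DoublyCommuteWith V W := by
  refine ⟨h, fun t s => ?_⟩
  have hn : IsStarNormal (V t) := ⟨(hV.normal t).symm⟩
  have h1 : Commute (star (V t)) (W s) := hn.commute_star_left (h t s)
  have h2 := h1.star_star
  rw [star_star] at h2
  exact h2

theorem mainTheorem5 {F : Type*} [NormedAddCommGroup F] [InnerProductSpace ℂ F] [CompleteSpace F]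
    (A : ℝ≥0 → HilbertTensor L2HalfLine F →L[ℂ] HilbertTensor L2HalfLine F) :
    (IsC0Semigroup A →
      (DoublyCommuteWith A (shiftTensor F) ↔
        ∃ B : ℝ≥0 → F →L[ℂ] F, IsC0Semigroup B ∧
          ∀ t, A t = tensorOp (ContinuousLinearMap.id ℂ L2HalfLine) (B t))) ∧
    (IsNormalC0Semigroup A →
      (CommuteWith A (shiftTensor F) ↔
        ∃ B : ℝ≥0 → F →L[ℂ] F, IsNormalC0Semigroup B ∧
          ∀ t, A t = tensorOp (ContinuousLinearMap.id ℂ L2HalfLine) (B t))) := by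
  refine ⟨fun hA => ⟨exists_isC0Semigroup_of_doublyCommuteWith hA,
    fun ⟨B, _, hB⟩ => doublyCommuteWith_shiftTensor_of_eq_tensorOp hB⟩, fun hA => ⟨fun h => ?_,
    fun ⟨B, _, hB⟩ => (doublyCommuteWith_shiftTensor_of_eq_tensorOp hB).1⟩⟩
  obtain ⟨B, hB, hAB⟩ := exists_isC0Semigroup_of_doublyCommuteWith hA.toIsC0Semigroup
    (hA.doublyCommuteWith h)
  refine ⟨B, ⟨hB, fun t => tensorOp_id_injective norm_icoIndicator_one ?_⟩, hAB⟩
  have hn := hA.normal t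
  simpa only [hAB t, adjoint_tensorOp, tensorOp_comp, ContinuousLinearMap.id_comp,
    ContinuousLinearMap.adjoint_id] using hn
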